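/- Let $S^k\subset\mathbb R^{k+1}$ be the unit sphere, with north pole $N_k=(0,\dots,0,1)$, and let $$\sigma_k:\mathbb R^k\to S^k,\qquad \sigma_k(x)=\left(\frac{2x}{|x|^2+1},\ \frac{|x|^2-1}{|x|^2+1}\right)$$ be (inverse) stereographic projection, a homeomorphism onto $S^k\setminus\{N_k\}$. A $C^2$ knot in $M$, where $M=S^3$ or $M=\mathbb R^3$, is a $C^2$ embedding $\alpha:S^1\to M$ (an injective $C^2$ map with nowhere vanishing derivative); a knot $\alpha$ in $\mathbb R^3$ is regarded as the knot $\sigma_3\circ\alpha$ in $S^3$. A polynomial knot is a smooth embedding $\kappa:\mathbb R\to\mathbb R^3$ whose three components are polynomials; its spherical completion is the map $\bar\kappa:S^1\to S^3$ with $\bar\kappa(\sigma_1(t))=\sigma_3(\kappa(t))$ for $t\in\mathbb R$ and $\bar\kappa(N_1)=N_3$. Two knots $\alpha_0,\alpha_1:S^1\to S^3$ have the same knot type if there are orientation-preserving homeomorphisms $f$ of $S^1$ and $g$ of $S^3$ with $\alpha_0=g\circ\alpha_1\circ f$. Proposition (Shastri). For every $C^2$ knot $\alpha$ in $S^3$ or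 in $\mathbb R^3$ there is a polynomial knot $\kappa:\mathbb R\to\mathbb R^3$ whose spherical completion $\bar\kappa$ has the same knot type as $\alpha$. -/

import Mathlib

open scoped Manifold ContDiff

noncomputable section

/-- Euclidean space `ℝⁿ`. -/
abbrev KnotEuclidean (n : ℕ) : Type := EuclideanSpace ℝ (Fin n)

/-- The unit sphere `Sⁿ ⊂ ℝⁿ⁺¹`, centred at the origin. -/
abbrev KnotSphere (n : ℕ) : Type := Metric.sphere (0 : EuclideanSpace ℝ (Fin (n + 1))) 1

/-- The coordinates `(2x / (|x|² + 1), (|x|² - 1) / (|x|² + 1))` of the point of `Sⁿ` that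
corresponds to `x ∈ ℝⁿ`. -/
def stereoCoords {n : ℕ} (x : KnotEuclidean n) : KnotEuclidean (n + 1) :=
  WithLp.toLp 2 (Fin.snoc (α := fun _ => ℝ) (fun i => 2 * x i / (‖x‖ ^ 2 + 1))
    ((‖x‖ ^ 2 - 1) / (‖x‖ ^ 2 + 1)))

theorem stereoCoords_mem {n : ℕ} (x : KnotEuclidean n) :
    stereoCoords x ∈ Metric.sphere (0 : EuclideanSpace ℝ (Fin (n + 1))) 1 := by
  have h0 : ‖x‖ ^ 2 + 1 ≠ 0 := by positivity
  have h1 : ∑ i, (2 * x i / (‖x‖ ^ 2 + 1)) ^ 2 = 4 * ‖x‖ ^ 2 / (‖x‖ ^ 2 + 1) ^ 2 := by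
    rw [EuclideanSpace.real_norm_sq_eq x, Finset.mul_sum, Finset.sum_div]
    exact Finset.sum_congr rfl fun i _ => by rw [div_pow]; ring
  have h2 : ‖stereoCoords x‖ ^ 2 = 1 := by
    rw [EuclideanSpace.real_norm_sq_eq, Fin.sum_univ_castSucc]
    simp only [stereoCoords, Fin.snoc_castSucc, Fin.snoc_last]
    rw [h1]
    field_simp
    ring
  rw [mem_sphere_zero_iff_norm]
  exact (sq_eq_sq₀ (norm_nonneg _) zero_le_one).1 (by rw [h2]; norm_num)

/-- Stereographic projection, as the inclusion `σ : ℝⁿ → Sⁿ` onto the complement of the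
north pole. -/
def stereoInclusion {n : ℕ} (x : KnotEuclidean n) : KnotSphere n :=
  ⟨stereoCoords x, stereoCoords_mem x⟩

/-- The north pole `(0, …, 0, 1)` of `Sⁿ`, the image of the point at infinity. -/
def northPole (n : ℕ) : KnotSphere n :=
  ⟨EuclideanSpace.single (Fin.last n) 1, by simp⟩

open Classical in
/-- The spherical completion `S¹ → Sⁿ` of a curve `κ : ℝ → ℝⁿ`: it takes the north pole to the
north pole, and any other point `p = σ(t)`, where `t = p₀ / (1 - p₁)`, to `σ(κ(t))`. -/
def sphericalCompletion {n : ℕ} (κ : ℝ → KnotEuclidean n) (p : KnotSphere 1) : KnotSphere n :=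
  if p = northPole 1 then northPole n
  else stereoInclusion (κ (p.1 0 / (1 - p.1 1)))

/-- A `C^k` embedding of manifolds: a `C^k` map that is an immersion (all its differentials are
injective) and a homeomorphism onto its image. -/
structure IsCkEmbedding {E H E' H' M N : Type*}
    [NormedAddCommGroup E] [NormedSpace ℝ E] [TopologicalSpace H]
    [NormedAddCommGroup E'] [NormedSpace ℝ E'] [TopologicalSpace H']
    [TopologicalSpace M] [ChartedSpace H M] [TopologicalSpace N] [ChartedSpace H' N]
    (I : ModelWithCorners ℝ E H) (J : ModelWithCorners ℝ E' H') (k : WithTop ℕ∞)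
    (f : M → N) : Prop where
  contMDiff : ContMDiff I J k f
  injective_mfderiv : ∀ x : M, Function.Injective (mfderiv I J f x)
  isEmbedding : Topology.IsEmbedding f

/-- A polynomial knot: a smooth embedding `ℝ → ℝⁿ` whose components are polynomials. -/
structure IsPolynomialKnot {n : ℕ} (κ : ℝ → KnotEuclidean n) : Prop where
  polynomial : ∃ P : Fin n → Polynomial ℝ, ∀ (t : ℝ) (i : Fin n), κ t i = (P i).eval t
  embedding : IsCkEmbedding 𝓘(ℝ, ℝ) 𝓘(ℝ, KnotEuclidean n) ∞ κ

/-- A self-homeomorphism of `Sⁿ` (`n ≥ 1`) preserves orientation if it has degree one, i.e. if it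
acts as the identity on the singular homology group `Hₙ(Sⁿ; ℤ)`. -/
def OrientationPreserving {n : ℕ} (g : KnotSphere n ≃ₜ KnotSphere n) : Prop :=
  ((AlgebraicTopology.singularHomologyFunctor (ModuleCat.{0} ℤ) n).obj (ModuleCat.of ℤ ℤ)).map
      (TopCat.ofHom (g : C(KnotSphere n, KnotSphere n))) =
    CategoryTheory.CategoryStruct.id _

/-- Two knots `S¹ → Sⁿ` have the same knot type if they differ by orientation-preserving
homeomorphisms of the circle and of the sphere. -/
def SameKnotType {n : ℕ} (α₀ α₁ : KnotSphere 1 → KnotSphere n) : Prop :=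
  ∃ (f : KnotSphere 1 ≃ₜ KnotSphere 1) (g : KnotSphere n ≃ₜ KnotSphere n),
    OrientationPreserving f ∧ OrientationPreserving g ∧ α₀ = g ∘ α₁ ∘ f

end

/-!
Rotate the sphere so that the knot passes through the north pole, and remove the pole. What is left
is a long knot `β : ℝ → ℝⁿ`, and since stereographic projection is the restriction of an inversion,
the velocity of `β` has the same nonzero limit `A` at both ends of the line. Hence `β` is
bi-Lipschitz onto its image. Since `β' - A` vanishes at infinity, after a polynomial change of
parameter `θ` it can be approximated by a polynomial curve, closely enough that integration gives a
polynomial curve `κ` for which `κ - β ∘ θ`, as a function on the image of `β`, has a small Lipschitz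
constant. It extends to a contraction `φ` of `ℝⁿ`, and `x ↦ x + φ x` is a homeomorphism which
carries `β ∘ θ` to `κ`. The segment from `x + φ x` to `x` leaves every bounded set as `x` tends to
infinity, so the straight-line homotopy to the identity extends to the sphere, and the homeomorphism
preserves orientation.
-/

open Filter Topology Set Bornology Asymptotics

theorem OrientationPreserving.of_homotopy {n : ℕ} {g : KnotSphere n ≃ₜ KnotSphere n}
    (H : ContinuousMap.Homotopy (g : C(KnotSphere n, KnotSphere n)) (ContinuousMap.id _)) :
    OrientationPreserving g := by
  have H' : TopCat.Homotopy (TopCat.ofHom (g : C(KnotSphere n, KnotSphere n)))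
      (CategoryTheory.CategoryStruct.id (TopCat.of (KnotSphere n))) := H
  refine (H'.congr_homologyMap_singularChainComplexFunctor
    (ModuleCat.of ℤ ℤ : ModuleCat.{0} ℤ) n).trans ?_
  exact ((AlgebraicTopology.singularHomologyFunctor (ModuleCat.{0} ℤ) n).obj
    (ModuleCat.of ℤ ℤ)).map_id (TopCat.of (KnotSphere n))

theorem OrientationPreserving.trans {n : ℕ} {g h : KnotSphere n ≃ₜ KnotSphere n}
    (hg : OrientationPreserving g) (hh : OrientationPreserving h) :
    OrientationPreserving (g.trans h) := by
  unfold OrientationPreserving at hg hh ⊢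
  have comp_eq : TopCat.ofHom (g.trans h : C(KnotSphere n, KnotSphere n)) =
      CategoryTheory.CategoryStruct.comp
        (TopCat.ofHom (g : C(KnotSphere n, KnotSphere n)))
        (TopCat.ofHom (h : C(KnotSphere n, KnotSphere n))) := rfl
  rw [comp_eq, CategoryTheory.Functor.map_comp, hg, hh, CategoryTheory.Category.comp_id]

theorem continuous_onePointMap_of_tendsto {T X Y : Type*} [TopologicalSpace T]
    [TopologicalSpace X] [TopologicalSpace Y] {H : T × X → Y} (hH : Continuous H)
    (hH_infty : ∀ t, Tendsto H (𝓝 t ×ˢ coclosedCompact X) (coclosedCompact Y)) :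
    Continuous fun p : T × OnePoint X => OnePoint.map (fun x => H (p.1, x)) p.2 := by
  rw [continuous_iff_continuousAt]
  rintro ⟨t, z⟩
  rw [ContinuousAt, nhds_prod_eq]
  induction z using OnePoint.rec with
  | infty =>
    rw [OnePoint.nhds_infty_eq (X := X), prod_sup, tendsto_sup, prod_map_right, tendsto_map'_iff]
    refine ⟨OnePoint.tendsto_coe_infty.comp (hH_infty t), ?_⟩
    rw [prod_pure, tendsto_map'_iff]
    exact tendsto_const_nhds
  | coe x =>
    rw [OnePoint.nhds_coe_eq, prod_map_right, tendsto_map'_iff, ← nhds_prod_eq]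
    exact (OnePoint.continuous_coe.comp hH).continuousAt

theorem isEmbedding_of_leftInverse_of_continuousAt {X Y : Type*} [TopologicalSpace X]
    [TopologicalSpace Y] {f : X → Y} {g : Y → X} (hf : Continuous f)
    (hgf : Function.LeftInverse g f) (hg : ∀ x, ContinuousAt g (f x)) : IsEmbedding f where
  injective := hgf.injective
  toIsInducing := isInducing_iff_nhds.2 fun x => by
    refine (hf.tendsto x).le_comap.antisymm ?_
    have h : Tendsto (g ∘ f) (comap f (𝓝 (f x))) (𝓝 (g (f x))) :=
      Tendsto.comp (hg x) tendsto_comap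
    rwa [hgf.comp_eq_id, hgf x] at h

section Embeddings

variable {E H E' H' E'' H'' M N P : Type*}
  [NormedAddCommGroup E] [NormedSpace ℝ E] [TopologicalSpace H]
  [NormedAddCommGroup E'] [NormedSpace ℝ E'] [TopologicalSpace H']
  [NormedAddCommGroup E''] [NormedSpace ℝ E''] [TopologicalSpace H'']
  [TopologicalSpace M] [ChartedSpace H M] [TopologicalSpace N] [ChartedSpace H' N]
  [TopologicalSpace P] [ChartedSpace H'' P]
  {I : ModelWithCorners ℝ E H} {J : ModelWithCorners ℝ E' H'} {I'' : ModelWithCorners ℝ E'' H''}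
  {k m : WithTop ℕ∞}

namespace IsCkEmbedding

theorem of_le {f : M → N} (hf : IsCkEmbedding I J k f) (hmk : m ≤ k) : IsCkEmbedding I J m f :=
  ⟨hf.contMDiff.of_le hmk, hf.injective_mfderiv, hf.isEmbedding⟩

theorem comp {g : N → P} {f : M → N} (hg : IsCkEmbedding J I'' k g) (hf : IsCkEmbedding I J k f)
    (hk : k ≠ 0) : IsCkEmbedding I I'' k (g ∘ f) where
  contMDiff := hg.contMDiff.comp hf.contMDiff
  injective_mfderiv x := by
    rw [mfderiv_comp x (hg.contMDiff.mdifferentiableAt hk) (hf.contMDiff.mdifferentiableAt hk)]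
    exact (hg.injective_mfderiv (f x)).comp (hf.injective_mfderiv x)
  isEmbedding := hg.isEmbedding.comp hf.isEmbedding

theorem of_comp {g : N → P} {f : M → N} (hg : ContMDiff J I'' k g) (hf : ContMDiff I J k f)
    (hgf : IsCkEmbedding I I'' k (g ∘ f)) (hk : k ≠ 0) : IsCkEmbedding I J k f where
  contMDiff := hf
  injective_mfderiv x := by
    have h_inj := hgf.injective_mfderiv x
    rw [mfderiv_comp x (hg.mdifferentiableAt hk) (hf.mdifferentiableAt hk)] at h_inj
    exact Function.Injective.of_comp (f := mfderiv J I'' g (f x)) h_inj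
  isEmbedding := .of_comp hf.continuous hg.continuous hgf.isEmbedding

theorem of_leftInverse {f : E → E'} {g : E' → E} (hf : ContDiff ℝ k f)
    (h_inv : Function.LeftInverse g f) (hg : ∀ x, DifferentiableAt ℝ g (f x)) (hk : k ≠ 0) :
    IsCkEmbedding 𝓘(ℝ, E) 𝓘(ℝ, E') k f where
  contMDiff := hf.contMDiff
  injective_mfderiv x := by
    have h_comp := fderiv_comp x (hg x) (hf.differentiable hk x)
    rw [h_inv.comp_eq_id, fderiv_id] at h_comp
    rw [mfderiv_eq_fderiv]
    exact Function.LeftInverse.injective (g := fderiv ℝ g (f x)) fun v =>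
      (congrArg (· v) h_comp).symm
  isEmbedding := isEmbedding_of_leftInverse_of_continuousAt hf.continuous h_inv
    fun x => (hg x).continuousAt

theorem of_deriv_ne_zero {f : ℝ → E} (hf : ContDiff ℝ k f) (h_deriv : ∀ t, deriv f t ≠ 0)
    (h_emb : IsEmbedding f) : IsCkEmbedding 𝓘(ℝ, ℝ) 𝓘(ℝ, E) k f where
  contMDiff := hf.contMDiff
  injective_mfderiv t := by
    rw [mfderiv_eq_fderiv]
    refine (injective_iff_map_eq_zero (fderiv ℝ f t)).2 fun s hs => ?_
    rw [← toSpanSingleton_deriv, ContinuousLinearMap.toSpanSingleton_apply] at hs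
    exact (smul_eq_zero.1 hs).resolve_right (h_deriv t)
  isEmbedding := h_emb

theorem deriv_ne_zero {f : ℝ → E} (hf : IsCkEmbedding 𝓘(ℝ, ℝ) 𝓘(ℝ, E) k f) (t : ℝ) :
    deriv f t ≠ 0 := by
  rw [← fderiv_apply_one_eq_deriv, ← mfderiv_eq_fderiv]
  exact (map_ne_zero_iff _ (hf.injective_mfderiv t)).2 (one_ne_zero : (1 : ℝ) ≠ 0)

theorem coe_knotSphere {n : ℕ} :
    IsCkEmbedding (𝓡 n) 𝓘(ℝ, KnotEuclidean (n + 1)) k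
      (Subtype.val : KnotSphere n → KnotEuclidean (n + 1)) := by
  have := Fact.mk (finrank_euclideanSpace_fin (𝕜 := ℝ) (n := n + 1))
  exact ⟨contMDiff_coe_sphere, injective_mvfderiv_subtypeVal_sphere, .subtypeVal⟩

theorem codRestrict_knotSphere [IsManifold I k M] {n : ℕ} {f : M → KnotEuclidean (n + 1)}
    (hf : IsCkEmbedding I 𝓘(ℝ, KnotEuclidean (n + 1)) k f)
    (h_mem : ∀ x, f x ∈ Metric.sphere (0 : KnotEuclidean (n + 1)) 1) (hk : k ≠ 0) :
    IsCkEmbedding I (𝓡 n) k fun x => (⟨f x, h_mem x⟩ : KnotSphere n) := by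
  have := Fact.mk (finrank_euclideanSpace_fin (𝕜 := ℝ) (n := n + 1))
  exact .of_comp coe_knotSphere.contMDiff (hf.contMDiff.codRestrict_sphere h_mem) hf hk

end IsCkEmbedding

end Embeddings

section Stereographic

variable {n : ℕ}

variable (n) in
/-- The projection of `ℝⁿ⁺¹` to the hyperplane `ℝⁿ` of the first `n` coordinates. -/
noncomputable def dropLast : KnotEuclidean (n + 1) →L[ℝ] KnotEuclidean n :=
  (EuclideanSpace.equiv (Fin n) ℝ).symm.toContinuousLinearMap ∘L
    ContinuousLinearMap.pi fun i => EuclideanSpace.proj i.castSucc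

theorem dropLast_apply (y : KnotEuclidean (n + 1)) (i : Fin n) : dropLast n y i = y i.castSucc :=
  rfl

/-- Stereographic projection from the north pole, extended by the same formula to the ambient
space; division by zero makes it vanish on the hyperplane tangent to the sphere at the pole. -/
noncomputable def stereoProj (y : KnotEuclidean (n + 1)) : KnotEuclidean n :=
  (1 - y (Fin.last n))⁻¹ • dropLast n y

theorem stereoProj_apply (y : KnotEuclidean (n + 1)) (i : Fin n) :
    stereoProj y i = y i.castSucc / (1 - y (Fin.last n)) := by
  rw [stereoProj, PiLp.smul_apply, dropLast_apply, smul_eq_mul, inv_mul_eq_div]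

theorem stereoCoords_castSucc (x : KnotEuclidean n) (i : Fin n) :
    stereoCoords x i.castSucc = 2 * x i / (‖x‖ ^ 2 + 1) := by
  simp [stereoCoords]

theorem stereoCoords_last (x : KnotEuclidean n) :
    stereoCoords x (Fin.last n) = (‖x‖ ^ 2 - 1) / (‖x‖ ^ 2 + 1) := by
  simp [stereoCoords]

theorem one_sub_stereoCoords_last (x : KnotEuclidean n) :
    1 - stereoCoords x (Fin.last n) = 2 / (‖x‖ ^ 2 + 1) := by
  rw [stereoCoords_last]
  field_simp
  ring

theorem stereoProj_stereoCoords (x : KnotEuclidean n) : stereoProj (stereoCoords x) = x := by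
  ext i
  simp only [stereoProj_apply, one_sub_stereoCoords_last, stereoCoords_castSucc]
  field_simp

theorem stereoInclusion_ne_northPole (x : KnotEuclidean n) : stereoInclusion x ≠ northPole n := by
  intro h
  have h_last := one_sub_stereoCoords_last x
  rw [show stereoCoords x = northPole n from congrArg Subtype.val h] at h_last
  have : 0 < 2 / (‖x‖ ^ 2 + 1) := by positivity
  simp only [northPole, PiLp.single_eq_same, sub_self] at h_last
  linarith

theorem sum_castSucc_sq (p : KnotSphere n) :
    ∑ i : Fin n, p.1 i.castSucc ^ 2 = 1 - p.1 (Fin.last n) ^ 2 := by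
  have h := EuclideanSpace.real_norm_sq_eq p.1
  rw [mem_sphere_zero_iff_norm.1 p.2, Fin.sum_univ_castSucc] at h
  linarith

theorem last_ne_one_of_ne_northPole {p : KnotSphere n} (hp : p ≠ northPole n) :
    p.1 (Fin.last n) ≠ 1 := by
  refine fun h => hp (Subtype.ext ?_)
  have h_zero : ∀ i : Fin n, p.1 i.castSucc = 0 := by
    have h_sum := sum_castSucc_sq p
    rw [h, one_pow, sub_self, Finset.sum_eq_zero_iff_of_nonneg fun i _ => sq_nonneg _] at h_sum
    exact fun i => pow_eq_zero_iff two_ne_zero |>.1 (h_sum i (Finset.mem_univ i))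
  ext i
  induction i using Fin.lastCases with
  | last => simp [northPole, h]
  | cast i => simp [northPole, h_zero, i.castSucc_ne_last]

theorem stereoInclusion_stereoProj {p : KnotSphere n} (hp : p ≠ northPole n) :
    stereoInclusion (stereoProj p.1) = p := by
  have h_last : 1 - p.1 (Fin.last n) ≠ 0 := sub_ne_zero.2 (last_ne_one_of_ne_northPole hp).symm
  have h_norm : ‖stereoProj p.1‖ ^ 2 = (1 + p.1 (Fin.last n)) / (1 - p.1 (Fin.last n)) := by
    rw [EuclideanSpace.real_norm_sq_eq]
    simp only [stereoProj_apply, div_pow]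
    rw [← Finset.sum_div, sum_castSucc_sq]
    field_simp
    ring
  ext i
  induction i using Fin.lastCases with
  | last =>
    rw [stereoInclusion, stereoCoords_last, h_norm]
    field_simp
    ring
  | cast i =>
    rw [stereoInclusion, stereoCoords_castSucc, h_norm, stereoProj_apply]
    field_simp
    ring

theorem contDiffAt_stereoProj {k : WithTop ℕ∞} {y : KnotEuclidean (n + 1)}
    (hy : y (Fin.last n) ≠ 1) : ContDiffAt ℝ k stereoProj y :=
  (ContDiffAt.inv (𝕜 := ℝ) (f := fun z : KnotEuclidean (n + 1) => 1 - z (Fin.last n))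
    (by fun_prop) (sub_ne_zero.2 hy.symm)).smul (dropLast n).contDiff.contDiffAt

theorem contDiff_stereoCoords {k : WithTop ℕ∞} : ContDiff ℝ k (stereoCoords (n := n)) := by
  have h_denom : ∀ x : KnotEuclidean n, ‖x‖ ^ 2 + 1 ≠ 0 := fun x => by positivity
  have h_norm : ContDiff ℝ k fun x : KnotEuclidean n => ‖x‖ ^ 2 := contDiff_norm_sq ℝ
  refine contDiff_euclidean.2 fun i => ?_
  induction i using Fin.lastCases with
  | last =>
    simp only [stereoCoords_last]
    exact (h_norm.sub contDiff_const).div (h_norm.add contDiff_const) h_denom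
  | cast i =>
    simp only [stereoCoords_castSucc]
    exact ContDiff.div (by fun_prop) (h_norm.add contDiff_const) h_denom

theorem isCkEmbedding_stereoInclusion {k : WithTop ℕ∞} (hk : k ≠ 0) :
    IsCkEmbedding 𝓘(ℝ, KnotEuclidean n) (𝓡 n) k (stereoInclusion (n := n)) :=
  (IsCkEmbedding.of_leftInverse contDiff_stereoCoords stereoProj_stereoCoords
    (fun x => (contDiffAt_stereoProj <| last_ne_one_of_ne_northPole <|
      stereoInclusion_ne_northPole x).differentiableAt one_ne_zero) hk).codRestrict_knotSphere
    stereoCoords_mem hk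

theorem range_stereoInclusion : range (stereoInclusion (n := n)) = {northPole n}ᶜ :=
  Subset.antisymm (range_subset_iff.2 stereoInclusion_ne_northPole)
    fun _ hp => ⟨_, stereoInclusion_stereoProj hp⟩

variable (n) in
/-- Stereographic projection, as an identification of the sphere with the one-point
compactification of Euclidean space. -/
noncomputable def stereoOnePoint : OnePoint (KnotEuclidean n) ≃ₜ KnotSphere n :=
  OnePoint.equivOfIsEmbeddingOfRangeEq (northPole n) stereoInclusion
    (isCkEmbedding_stereoInclusion one_ne_zero).isEmbedding
    range_stereoInclusion

/-- The real line as the one-dimensional Euclidean space. -/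
noncomputable def lineIso : ℝ ≃ₗᵢ[ℝ] KnotEuclidean 1 :=
  (OrthonormalBasis.singleton (Fin 1) ℝ).repr

theorem lineIso_apply (t : ℝ) (i : Fin 1) : lineIso t i = t :=
  OrthonormalBasis.singleton_repr t i

theorem lineIso_symm_apply (x : KnotEuclidean 1) : lineIso.symm x = x 0 := by
  conv_rhs => rw [← lineIso.apply_symm_apply x, lineIso_apply]

theorem sphericalCompletion_stereoOnePoint (κ : ℝ → KnotEuclidean n)
    (z : OnePoint (KnotEuclidean 1)) :
    sphericalCompletion κ (stereoOnePoint 1 z) =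
      stereoOnePoint n (OnePoint.map (κ ∘ lineIso.symm) z) := by
  induction z using OnePoint.rec with
  | infty => exact if_pos rfl
  | coe x =>
    refine (if_neg (stereoInclusion_ne_northPole x)).trans ?_
    have h : stereoProj (stereoCoords x) 0 = lineIso.symm x := by
      rw [stereoProj_stereoCoords, lineIso_symm_apply]
    exact congrArg (fun t => stereoInclusion (κ t)) ((stereoProj_apply _ 0).symm.trans h)

/-- The homeomorphism of the sphere that extends a homeomorphism `h` of Euclidean space and fixes
the north pole. -/
noncomputable def sphereHomeo (h : KnotEuclidean n ≃ₜ KnotEuclidean n) :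
    KnotSphere n ≃ₜ KnotSphere n :=
  (stereoOnePoint n).symm.trans (h.onePointCongr.trans (stereoOnePoint n))

theorem sphereHomeo_stereoOnePoint (h : KnotEuclidean n ≃ₜ KnotEuclidean n)
    (z : OnePoint (KnotEuclidean n)) :
    sphereHomeo h (stereoOnePoint n z) = stereoOnePoint n (OnePoint.map h z) := by
  simp [sphereHomeo]

theorem orientationPreserving_sphereHomeo {h : KnotEuclidean n ≃ₜ KnotEuclidean n}
    (hh : ∀ M : ℝ, ∀ᶠ x in cobounded (KnotEuclidean n), ∀ y ∈ segment ℝ (h x) x, M ≤ ‖y‖) :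
    OrientationPreserving (sphereHomeo h) := by
  let H : unitInterval × KnotEuclidean n → KnotEuclidean n := fun p =>
    AffineMap.lineMap (h p.2) p.2 (p.1 : ℝ)
  have hH : Continuous H := by
    simp only [H, AffineMap.lineMap_apply_module]
    fun_prop
  have hH_infty : ∀ t, Tendsto H (𝓝 t ×ˢ coclosedCompact _) (coclosedCompact _) := fun t => by
    rw [coclosedCompact_eq_cocompact, ← Metric.cobounded_eq_cocompact,
      ← tendsto_norm_atTop_iff_cobounded, tendsto_atTop]
    intro M
    filter_upwards [tendsto_snd.eventually (hh M)] with p hp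
    exact hp _ (lineMap_mem_segment _ _ _ p.1.2)
  refine .of_homotopy
    { toFun := fun p => stereoOnePoint n
        (OnePoint.map (fun x => H (p.1, x)) ((stereoOnePoint n).symm p.2))
      continuous_toFun := (stereoOnePoint n).continuous.comp <|
        (continuous_onePointMap_of_tendsto hH hH_infty).comp <|
          continuous_id.prodMap (stereoOnePoint n).symm.continuous
      map_zero_left := fun p => ?_
      map_one_left := fun p => ?_ }
  · simp [H, sphereHomeo]
  · have hH_one : (fun x => H (1, x)) = id := by
      ext1 x
      simp [H]
    simp [hH_one]

end Stereographic

section LipschitzPerturbation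

open scoped NNReal

variable {E : Type*} [NormedAddCommGroup E] [NormedSpace ℝ E]

/-- The homeomorphism `x ↦ x + φ x` of a Banach space, for a contraction `φ`. -/
noncomputable def addContractionHomeo [CompleteSpace E] {c : ℝ≥0} (hc : c < 1) {φ : E → E}
    (hφ : LipschitzWith c φ) : E ≃ₜ E :=
  ApproximatesLinearOn.toHomeomorph (𝕜 := ℝ) (fun x => x + φ x)
    (f' := ContinuousLinearEquiv.refl ℝ E) (c := c)
    (fun x _ y _ => by
      have h : x + φ x - (y + φ y) - (x - y) = φ x - φ y := by abel
      simpa [h] using hφ.norm_sub_le x y)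
    (by
      rcases subsingleton_or_nontrivial E with hE | hE
      · exact .inl hE
      · have h_norm : ‖((ContinuousLinearEquiv.refl ℝ E).symm : E →L[ℝ] E)‖₊ = 1 :=
          NNReal.eq ContinuousLinearMap.norm_id
        exact .inr (by rwa [h_norm, inv_one]))

theorem addContractionHomeo_apply [CompleteSpace E] {c : ℝ≥0} (hc : c < 1) {φ : E → E}
    (hφ : LipschitzWith c φ) (x : E) : addContractionHomeo hc hφ x = x + φ x := rfl

theorem antilipschitzWith_addContractionHomeo [CompleteSpace E] {c : ℝ≥0} (hc : c < 1) {φ : E → E}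
    (hφ : LipschitzWith c φ) : AntilipschitzWith (1 - c)⁻¹ (addContractionHomeo hc hφ) := by
  rw [← inv_one (G := ℝ≥0)]
  exact AntilipschitzWith.id.add_lipschitzWith hφ (by rwa [inv_one])

theorem eventually_forall_segment_add_contraction {c : ℝ≥0} (hc : c < 1) {φ : E → E}
    (hφ : LipschitzWith c φ) (M : ℝ) :
    ∀ᶠ x in cobounded E, ∀ y ∈ segment ℝ (x + φ x) x, M ≤ ‖y‖ := by
  have hc' : 0 < 1 - (c : ℝ) := sub_pos.2 hc
  filter_upwards [tendsto_norm_cobounded_atTop.eventually_ge_atTop ((M + ‖φ 0‖) / (1 - c))]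
    with x hx y hy
  rw [div_le_iff₀ hc'] at hx
  have h_seg := norm_sub_le_of_mem_segment (segment_symm ℝ (x + φ x) x ▸ hy)
  rw [norm_sub_rev, add_sub_cancel_left] at h_seg
  have hφ_zero : ‖φ x - φ 0‖ ≤ c * ‖x‖ := by simpa using hφ.norm_sub_le x 0
  have := norm_sub_norm_le (φ x) (φ 0)
  have := norm_sub_norm_le x y
  linarith

theorem exists_lipschitz_extension_along [FiniteDimensional ℝ E] {X : Type*} [EMetricSpace X]
    {K : ℝ≥0} {β : X → E} (hβ : AntilipschitzWith K β) {c : ℝ≥0} (hc : 0 < c) :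
    ∃ ε : ℝ≥0, 0 < ε ∧ ∀ δ : X → E, LipschitzWith ε δ →
      ∃ φ : E → E, LipschitzWith c φ ∧ ∀ x, φ (β x) = δ x := by
  let C := lipschitzExtensionConstant E
  refine ⟨c / (C * K + 1), by positivity, fun δ hδ => ?_⟩
  have h_lip : LipschitzOnWith (c / (C * K + 1) * K) (Function.extend β δ 0) (range β) := by
    rintro _ ⟨x, rfl⟩ _ ⟨y, rfl⟩
    rw [hβ.injective.extend_apply, hβ.injective.extend_apply]
    refine (hδ x y).trans ?_
    rw [ENNReal.coe_mul, mul_assoc]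
    gcongr
    exact hβ x y
  obtain ⟨φ, hφ, h_eq⟩ := h_lip.extend_finite_dimension
  refine ⟨φ, hφ.weaken ?_, fun x => ?_⟩
  · calc C * (c / (C * K + 1) * K) = c * (C * K / (C * K + 1)) := by ring
      _ ≤ c * 1 := by gcongr; exact div_le_one_of_le₀ (by simp) (by simp)
      _ = c := mul_one c
  · rw [← h_eq (mem_range_self x), hβ.injective.extend_apply]

end LipschitzPerturbation

theorem eventually_forall_segment_orderIso (θ : ℝ ≃o ℝ) (M : ℝ) :
    ∀ᶠ t in cobounded ℝ, ∀ s ∈ segment ℝ (θ t) t, M ≤ |s| := by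
  rw [IsOrderBornology.cobounded_eq, eventually_sup]
  constructor
  · filter_upwards [eventually_le_atBot (-M), θ.tendsto_atBot.eventually_le_atBot (-M)]
      with t ht hθt s hs
    have h_neg : s ≤ -M := (convex_Iic (-M)).segment_subset hθt ht hs
    exact (le_neg_of_le_neg h_neg).trans (neg_le_abs s)
  · filter_upwards [eventually_ge_atTop M, θ.tendsto_atTop.eventually_ge_atTop M]
      with t ht hθt s hs
    exact ((convex_Ici M).segment_subset hθt ht hs).trans (le_abs_self s)

/-- The self-homeomorphism of the circle induced by an increasing bijection of the line. -/
noncomputable def circleReparam (θ : ℝ ≃o ℝ) : KnotSphere 1 ≃ₜ KnotSphere 1 :=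
  sphereHomeo (lineIso.symm.toHomeomorph.trans (θ.toHomeomorph.trans lineIso.toHomeomorph))

theorem orientationPreserving_circleReparam (θ : ℝ ≃o ℝ) :
    OrientationPreserving (circleReparam θ) := by
  refine orientationPreserving_sphereHomeo fun M => ?_
  filter_upwards [lineIso.symm.antilipschitz.tendsto_cobounded.eventually
    (eventually_forall_segment_orderIso θ M)] with x hx y hy
  have h_mem : lineIso.symm y ∈ segment ℝ (θ (lineIso.symm x)) (lineIso.symm x) := by
    have h := mem_image_of_mem lineIso.symm.toLinearEquiv.toLinearMap.toAffineMap hy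
    rw [image_segment] at h
    simpa using h
  simpa [← Real.norm_eq_abs] using hx _ h_mem

theorem sameKnotType_sphericalCompletion {n : ℕ} {h : KnotEuclidean n ≃ₜ KnotEuclidean n}
    (hh : OrientationPreserving (sphereHomeo h)) (β : ℝ → KnotEuclidean n) (θ : ℝ ≃o ℝ) :
    SameKnotType (sphericalCompletion (h ∘ β ∘ θ)) (sphericalCompletion β) := by
  refine ⟨circleReparam θ, sphereHomeo h, orientationPreserving_circleReparam θ, hh, ?_⟩
  funext p
  obtain ⟨z, rfl⟩ := (stereoOnePoint 1).surjective p
  simp only [Function.comp_apply, circleReparam, sphereHomeo_stereoOnePoint,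
    sphericalCompletion_stereoOnePoint]
  induction z using OnePoint.rec with
  | infty => rfl
  | coe x => simp

section LongKnots

variable {E : Type*} [NormedAddCommGroup E]

theorem isBigO_top_of_forall_nhds_of_cocompact {X F : Type*} [TopologicalSpace X]
    [NormedAddCommGroup F] {f : X → E} {g : X → F} (h_nhds : ∀ x, f =O[𝓝 x] g)
    (h_infty : f =O[cocompact X] g) : f =O[⊤] g := by
  obtain ⟨C, hC⟩ := h_infty.bound
  obtain ⟨K, hK, hKC⟩ := mem_cocompact.1 hC
  have h_compact : f =O[𝓟 K] g := by
    refine hK.induction_on (by simp) (fun s t hst ht => ht.mono (principal_mono.2 hst))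
      (fun s t hs ht => sup_principal ▸ hs.sup ht) fun x _ => ?_
    obtain ⟨C, hC⟩ := (h_nhds x).bound
    exact ⟨_, mem_nhdsWithin_of_mem_nhds hC, .of_bound C (mem_principal_self _)⟩
  have h_compl : f =O[𝓟 Kᶜ] g := .of_bound C hKC
  have h_union := h_compact.sup h_compl
  rwa [sup_principal, union_compl_self, principal_univ] at h_union

variable [NormedSpace ℝ E]

theorem norm_sub_le_sub_of_norm_deriv_le {f f' : ℝ → E} {B B' : ℝ → ℝ}
    (hf : ∀ t, HasDerivAt f (f' t) t) (hB : ∀ t, HasDerivAt B (B' t) t)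
    (h_le : ∀ t, ‖f' t‖ ≤ B' t) {s t : ℝ} (hst : s ≤ t) : ‖f t - f s‖ ≤ B t - B s := by
  refine image_norm_le_of_norm_deriv_right_le_deriv_boundary (f := fun r => f r - f s)
    (B := fun r => B r - B s) (a := s) (b := t)
    (fun r _ => (((hf r).sub_const _).continuousAt).continuousWithinAt)
    (fun r _ => ((hf r).sub_const _).hasDerivWithinAt) (by simp)
    (fun r => (hB r).sub_const _) (fun r _ => h_le r) ⟨hst, le_rfl⟩

section VanishingDeriv

variable {f f' : ℝ → E}

theorem exists_norm_le_add_mul_one_div_one_add_sq (hf' : Continuous f')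
    (hf'_zero : Tendsto f' (cobounded ℝ) (𝓝 0)) {ε : ℝ} (hε : 0 < ε) :
    ∃ C, 0 ≤ C ∧ ∀ t, ‖f' t‖ ≤ ε + C * (1 / (1 + t ^ 2)) := by
  obtain ⟨K, hK, hKε⟩ := mem_cocompact.1 <| Metric.cobounded_eq_cocompact (α := ℝ) ▸
    hf'_zero.norm.eventually_le_const (norm_zero.trans_lt hε)
  have h_cont : Continuous fun t => (1 + t ^ 2) • f' t := by fun_prop
  obtain ⟨C, hC⟩ := hK.exists_bound_of_continuousOn h_cont.continuousOn
  refine ⟨max C 0, le_max_right _ _, fun t => ?_⟩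
  by_cases ht : t ∈ K
  · have h_le := (hC t ht).trans (le_max_left C 0)
    have h_pos : 0 < 1 + t ^ 2 := by positivity
    rw [norm_smul, Real.norm_of_nonneg h_pos.le, mul_comm, ← le_div_iff₀ h_pos] at h_le
    exact h_le.trans (by rw [mul_one_div]; linarith)
  · exact (hKε ht).trans (le_add_of_nonneg_right (by positivity))

theorem exists_norm_sub_le_mul_of_le_abs_sub (hf : ∀ t, HasDerivAt f (f' t) t)
    (hf' : Continuous f') (hf'_zero : Tendsto f' (cobounded ℝ) (𝓝 0)) {ε : ℝ} (hε : 0 < ε) :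
    ∃ L, ∀ s t, L ≤ |s - t| → ‖f s - f t‖ ≤ ε * |s - t| := by
  obtain ⟨C, hC, h_le⟩ := exists_norm_le_add_mul_one_div_one_add_sq hf' hf'_zero (half_pos hε)
  refine ⟨C * Real.pi / (ε / 2), fun s t hst => ?_⟩
  wlog hts : t ≤ s generalizing s t
  · rw [norm_sub_rev, abs_sub_comm]
    exact this t s (by rwa [abs_sub_comm]) (le_of_not_ge hts)
  rw [abs_of_nonneg (sub_nonneg.2 hts)] at hst ⊢
  rw [div_le_iff₀ (half_pos hε)] at hst
  have hB (r : ℝ) : HasDerivAt (fun r => ε / 2 * r + C * Real.arctan r)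
      (ε / 2 + C * (1 / (1 + r ^ 2))) r := by
    simpa using
      ((hasDerivAt_id r).const_mul (ε / 2)).fun_add ((Real.hasDerivAt_arctan r).const_mul C)
  have h_arctan : C * (Real.arctan s - Real.arctan t) ≤ C * Real.pi := by
    have := Real.arctan_lt_pi_div_two s
    have := Real.neg_pi_div_two_lt_arctan t
    gcongr
    linarith
  linarith [norm_sub_le_sub_of_norm_deriv_le hf hB h_le hts]

theorem eventually_norm_sub_le_mul_of_abs_sub_le (hf : ∀ t, HasDerivAt f (f' t) t)
    (hf'_zero : Tendsto f' (cobounded ℝ) (𝓝 0)) {ε : ℝ} (hε : 0 < ε) (L : ℝ) :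
    ∀ᶠ p : ℝ × ℝ in cocompact (ℝ × ℝ), |p.1 - p.2| ≤ L →
      ‖f p.1 - f p.2‖ ≤ ε * |p.1 - p.2| := by
  obtain ⟨R, -, hR⟩ := (hasBasis_cobounded_norm (E := ℝ)).eventually_iff.1 <|
    hf'_zero.norm.eventually_le_const (norm_zero.trans_lt hε)
  rw [← Metric.cobounded_eq_cocompact]
  filter_upwards [tendsto_norm_cobounded_atTop.eventually_ge_atTop (R + L)] with p hp hpL
  have h_seg : ∀ r ∈ uIcc p.2 p.1, R ≤ ‖r‖ := fun r hr => by
    have h₁ := abs_sub_left_of_mem_uIcc hr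
    have h₂ := abs_sub_right_of_mem_uIcc hr
    rw [Prod.norm_def] at hp
    rcases le_max_iff.1 hp with h | h
    · have := norm_sub_norm_le p.1 r
      rw [Real.norm_eq_abs (p.1 - r)] at this
      linarith
    · have := norm_sub_norm_le p.2 r
      rw [Real.norm_eq_abs (p.2 - r), abs_sub_comm] at this
      linarith
  exact (convex_uIcc p.2 p.1).norm_image_sub_le_of_norm_hasDerivWithin_le
    (fun r _ => (hf r).hasDerivWithinAt) (fun r hr => hR (h_seg r hr)) left_mem_uIcc right_mem_uIcc

end VanishingDeriv

theorem hasDerivAtFilter_cocompact_of_tendsto_deriv {β : ℝ → E} (hβ : ContDiff ℝ 1 β) {A : E}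
    (hA : Tendsto (deriv β) (cobounded ℝ) (𝓝 A)) : HasDerivAtFilter β A (cocompact (ℝ × ℝ)) := by
  rw [hasDerivAtFilter_iff_isLittleO, isLittleO_iff]
  intro ε hε
  let f : ℝ → E := fun t => β t - t • A
  have hf (t : ℝ) : HasDerivAt f (deriv β t - A) t := by
    simpa using
      (hβ.differentiable one_ne_zero t).hasDerivAt.fun_sub ((hasDerivAt_id t).smul_const A)
  have h_cont : Continuous fun t => deriv β t - A := by
    have := hβ.continuous_deriv le_rfl
    fun_prop
  have h_zero : Tendsto (fun t => deriv β t - A) (cobounded ℝ) (𝓝 0) := by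
    simpa using hA.sub_const A
  obtain ⟨L, hL⟩ := exists_norm_sub_le_mul_of_le_abs_sub hf h_cont h_zero hε
  filter_upwards [eventually_norm_sub_le_mul_of_abs_sub_le hf h_zero hε L] with p hp
  have h_eq : β p.1 - β p.2 - (p.1 - p.2) • A = f p.1 - f p.2 := by
    simp only [f, sub_smul]
    abel
  rw [h_eq, Real.norm_eq_abs]
  exact (le_total L |p.1 - p.2|).elim (hL _ _) hp

/-- A long knot: a regular injective `C¹` curve whose velocity converges, as the parameter goes to
either end of the line, to one and the same nonzero vector. -/
structure IsLongKnot (β : ℝ → E) : Prop where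
  contDiff : ContDiff ℝ 1 β
  injective : Function.Injective β
  deriv_ne_zero : ∀ t, deriv β t ≠ 0
  exists_tendsto_deriv : ∃ A ≠ 0, Tendsto (deriv β) (cobounded ℝ) (𝓝 A)

theorem IsLongKnot.exists_antilipschitzWith {β : ℝ → E} (hβ : IsLongKnot β) :
    ∃ K, AntilipschitzWith K β := by
  obtain ⟨A, hA, hA_lim⟩ := hβ.exists_tendsto_deriv
  have h_infty : (fun p : ℝ × ℝ => p.1 - p.2) =O[cocompact (ℝ × ℝ)] fun p => β p.1 - β p.2 :=
    (hasDerivAtFilter_cocompact_of_tendsto_deriv hβ.contDiff hA_lim).isTheta_sub hA |>.isBigO_symm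
  have h_nhds (q : ℝ × ℝ) :
      (fun p : ℝ × ℝ => p.1 - p.2) =O[𝓝 q] fun p => β p.1 - β p.2 := by
    obtain ⟨s, t⟩ := q
    by_cases hst : s = t
    · subst hst
      have h_strict := hβ.contDiff.hasStrictDerivAt one_ne_zero (x := s)
      exact (h_strict.isTheta_sub (hβ.deriv_ne_zero s)).isBigO_symm
    · have h_sub : Continuous fun p : ℝ × ℝ => β p.1 - β p.2 := by
        have := hβ.contDiff.continuous
        fun_prop
      have h_ne : β s - β t ≠ 0 := sub_ne_zero.2 (hβ.injective.ne hst)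
      have h_one : (fun _ => (1 : ℝ)) =O[𝓝 (s, t)] fun p => β p.1 - β p.2 :=
        isBigO_const_left_iff_pos_le_norm one_ne_zero |>.2 ⟨_, half_pos (norm_pos_iff.2 h_ne),
          h_sub.norm.continuousAt.eventually_const_le (half_lt_self (norm_pos_iff.2 h_ne))⟩
      exact ((continuous_fst.sub continuous_snd).tendsto (s, t)).isBigO_one ℝ |>.trans h_one
  obtain ⟨C, hC⟩ := isBigO_top.1 (isBigO_top_of_forall_nhds_of_cocompact h_nhds h_infty)
  refine ⟨C.toNNReal, .of_le_mul_dist fun s t => ?_⟩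
  rw [dist_eq_norm, dist_eq_norm]
  exact (hC (s, t)).trans (by gcongr; exact Real.le_coe_toNNReal C)

end LongKnots

section PolynomialCurves

open Polynomial

theorem exists_polynomial_hasDerivAt (q : ℝ[X]) :
    ∃ p : ℝ[X], ∀ t, HasDerivAt (fun s => p.eval s) (q.eval t) t := by
  induction q using Polynomial.induction_on' with
  | add q₁ q₂ h₁ h₂ =>
    obtain ⟨p₁, hp₁⟩ := h₁
    obtain ⟨p₂, hp₂⟩ := h₂
    exact ⟨p₁ + p₂, fun t => by simpa using (hp₁ t).fun_add (hp₂ t)⟩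
  | monomial k a =>
    have h_ne : (k : ℝ) + 1 ≠ 0 := by positivity
    have h_deriv : derivative (monomial (k + 1) (a / (k + 1))) = monomial k a := by
      simp [h_ne]
    exact ⟨_, fun t => h_deriv ▸ Polynomial.hasDerivAt _ t⟩

theorem exists_forall_abs_eval_le_mul_pow (q : ℝ[X]) {r η : ℝ} (hr : 1 < r) (hη : 0 < η) :
    ∃ m : ℕ, ∀ x, r ≤ |x| → |q.eval x| ≤ η * x ^ (2 * m) := by
  set C : ℝ := ∑ i ∈ Finset.range (q.natDegree + 1), |q.coeff i|
  obtain ⟨k, hk⟩ := pow_unbounded_of_one_lt (C / η) hr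
  refine ⟨q.natDegree + k, fun x hx => ?_⟩
  have h_one : 1 ≤ |x| := hr.le.trans hx
  have h_eval : |q.eval x| ≤ C * |x| ^ q.natDegree := by
    rw [eval_eq_sum_range, Finset.sum_mul]
    refine (Finset.abs_sum_le_sum_abs _ _).trans (Finset.sum_le_sum fun i hi => ?_)
    rw [abs_mul, abs_pow]
    gcongr
    exact Finset.mem_range_succ_iff.1 hi
  have hC : C ≤ η * |x| ^ k := by
    rw [← div_le_iff₀' hη]
    exact hk.le.trans (by gcongr)
  calc |q.eval x| ≤ C * |x| ^ q.natDegree := h_eval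
    _ ≤ η * |x| ^ k * |x| ^ q.natDegree := by gcongr
    _ = η * |x| ^ (q.natDegree + k) := by ring
    _ ≤ η * |x| ^ (2 * (q.natDegree + k)) := by
      gcongr
      lia
    _ = η * x ^ (2 * (q.natDegree + k)) := by rw [Even.pow_abs (even_two_mul _)]

variable {n : ℕ}

/-- A curve in `ℝⁿ` whose components are polynomials. -/
def IsPolynomialCurve (κ : ℝ → KnotEuclidean n) : Prop :=
  ∃ P : Fin n → ℝ[X], ∀ t i, κ t i = (P i).eval t

namespace IsPolynomialCurve

variable {κ κ₁ κ₂ : ℝ → KnotEuclidean n}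

theorem add (h₁ : IsPolynomialCurve κ₁) (h₂ : IsPolynomialCurve κ₂) :
    IsPolynomialCurve fun t => κ₁ t + κ₂ t := by
  obtain ⟨P₁, hP₁⟩ := h₁
  obtain ⟨P₂, hP₂⟩ := h₂
  exact ⟨P₁ + P₂, fun t i => by simp [hP₁, hP₂]⟩

theorem eval_smul_const (q : ℝ[X]) (v : KnotEuclidean n) :
    IsPolynomialCurve fun t => q.eval t • v :=
  ⟨fun i => q * C (v i), fun t i => by simp⟩

theorem contDiff {k : WithTop ℕ∞} (h : IsPolynomialCurve κ) : ContDiff ℝ k κ := by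
  obtain ⟨P, hP⟩ := h
  refine contDiff_euclidean.2 fun i => ?_
  simp only [hP]
  exact Polynomial.contDiff_aeval (P i) k

theorem exists_hasDerivAt (h : IsPolynomialCurve κ) :
    ∃ κ' : ℝ → KnotEuclidean n, IsPolynomialCurve κ' ∧ ∀ t, HasDerivAt κ' (κ t) t := by
  obtain ⟨Q, hQ⟩ := h
  choose P hP using fun i => exists_polynomial_hasDerivAt (Q i)
  refine ⟨fun t => WithLp.toLp 2 fun i => (P i).eval t, ⟨P, fun _ _ => rfl⟩, fun t => ?_⟩
  have h_pi : HasDerivAt (fun s i => (P i).eval s) (WithLp.ofLp (κ t)) t :=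
    hasDerivAt_pi.2 fun i => by simpa only [hQ] using hP i t
  exact (PiLp.hasFDerivAt_toLp (𝕜 := ℝ) 2 _).comp_hasDerivAt t h_pi

theorem exists_forall_norm_le_mul_pow (h : IsPolynomialCurve κ) {S η : ℝ} (hS : 0 < S)
    (hη : 0 < η) : ∃ m : ℕ, ∀ t, S + 1 ≤ |t| → ‖κ t‖ ≤ η * (t / S) ^ (2 * m) := by
  obtain ⟨P, hP⟩ := h
  let q : ℝ[X] := (1 + ∑ i, P i ^ 2).comp (C S * X)
  have hq (t : ℝ) : q.eval (t / S) = 1 + ‖κ t‖ ^ 2 := by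
    simp [q, EuclideanSpace.real_norm_sq_eq, hP, eval_finsetSum, mul_div_cancel₀ t hS.ne']
  obtain ⟨m, hm⟩ := exists_forall_abs_eval_le_mul_pow q ((one_lt_div hS).2 (lt_add_one S)) hη
  refine ⟨m, fun t ht => ?_⟩
  have h_le := hm (t / S) (by rw [abs_div, abs_of_pos hS]; gcongr)
  rw [hq] at h_le
  nlinarith [le_abs_self (1 + ‖κ t‖ ^ 2), sq_nonneg (‖κ t‖ - 1)]

end IsPolynomialCurve

theorem exists_isPolynomialCurve_near {u : ℝ → KnotEuclidean n} (hu : Continuous u) (S : ℝ)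
    {ε : ℝ} (hε : 0 < ε) :
    ∃ κ, IsPolynomialCurve κ ∧ ∀ t, |t| ≤ S → ‖κ t - u t‖ ≤ ε := by
  let e := EuclideanSpace.equiv (Fin n) ℝ
  obtain ⟨C, hC, h_bound⟩ := e.symm.toContinuousLinearMap.bound
  have h_exists (i : Fin n) : ∃ p : ℝ[X], ∀ t ∈ Icc (-S) S, |p.eval t - u t i| < ε / C :=
    exists_polynomial_near_of_continuousOn _ _ (fun t => u t i) (by fun_prop) _ (by positivity)
  choose P hP using h_exists
  refine ⟨fun t => e.symm fun i => (P i).eval t, ⟨P, fun _ _ => rfl⟩, fun t ht => ?_⟩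
  have h_pi : ‖(fun i => (P i).eval t) - e (u t)‖ ≤ ε / C :=
    (pi_norm_le_iff_of_nonneg (by positivity)).2 fun i => (hP i t (abs_le.1 ht)).le
  calc ‖e.symm (fun i => (P i).eval t) - u t‖
      = ‖e.symm ((fun i => (P i).eval t) - e (u t))‖ := by rw [map_sub, e.symm_apply_apply]
    _ ≤ C * (ε / C) := (h_bound _).trans (by gcongr)
    _ = ε := mul_div_cancel₀ ε hC.ne'

end PolynomialCurves

section PolynomialApproximation

open Polynomial
open scoped ZeroAtInfty

section Stretching

variable {θ θ' : ℝ → ℝ}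

theorem antilipschitzWith_one_of_one_le_deriv (hθ : ∀ t, HasDerivAt θ (θ' t) t)
    (hθ' : ∀ t, 1 ≤ θ' t) : AntilipschitzWith 1 θ := by
  refine .of_le_mul_dist fun s t => ?_
  wlog hst : s ≤ t generalizing s t
  · simpa only [dist_comm] using this t s (le_of_not_ge hst)
  have h_le := mul_sub_le_image_sub_of_le_deriv (fun t => (hθ t).differentiableAt)
    (fun t => (hθ t).deriv.symm ▸ hθ' t) hst
  rw [one_mul] at h_le
  rw [dist_comm, dist_comm (θ s), Real.dist_eq, Real.dist_eq, abs_of_nonneg (sub_nonneg.2 hst)]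
  simpa using h_le.trans (le_abs_self _)

theorem exists_orderIso_eq_of_one_le_deriv (hθ : ∀ t, HasDerivAt θ (θ' t) t)
    (hθ' : ∀ t, 1 ≤ θ' t) : ∃ e : ℝ ≃o ℝ, ⇑e = θ := by
  have h_mono : StrictMono θ := strictMono_of_hasDerivAt_pos hθ fun t => one_pos.trans_le (hθ' t)
  have h_cont : Continuous θ := continuous_iff_continuousAt.2 fun t => (hθ t).continuousAt
  have h_le {s t : ℝ} (hst : s ≤ t) : t - s ≤ θ t - θ s := by
    have := mul_sub_le_image_sub_of_le_deriv (fun t => (hθ t).differentiableAt)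
      (fun t => (hθ t).deriv.symm ▸ hθ' t) hst
    rwa [one_mul] at this
  have h_top : Tendsto θ atTop atTop := by
    refine tendsto_atTop_mono' _ ?_ (tendsto_atTop_add_const_right _ (θ 0) tendsto_id)
    filter_upwards [eventually_ge_atTop 0] with t ht
    simpa [← le_sub_iff_add_le] using h_le ht
  have h_bot : Tendsto θ atBot atBot := by
    refine tendsto_atBot_mono' _ ?_ (tendsto_atBot_add_const_right _ (θ 0) tendsto_id)
    filter_upwards [eventually_le_atBot 0] with t ht
    have := h_le ht
    simp only [id]
    linarith
  exact ⟨h_mono.orderIsoOfSurjective θ (h_cont.surjective h_top h_bot), rfl⟩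

theorem div_pow_two_mul_le_one {S t : ℝ} (hS : 0 < S) (ht : |t| ≤ S) (m : ℕ) :
    (t / S) ^ (2 * m) ≤ 1 := by
  rw [← (even_two_mul m).pow_abs, abs_div, abs_of_pos hS]
  exact pow_le_one₀ (by positivity) ((div_le_one hS).2 ht)

theorem exists_polynomial_stretching {S η : ℝ} (hS : 0 < S) (hη : 0 < η) (m : ℕ) :
    ∃ (ρ : ℝ[X]) (θ : ℝ → ℝ), (∀ t, ρ.eval t = 1 + η * (t / S) ^ (2 * m)) ∧
      (∀ t, HasDerivAt θ (ρ.eval t) t) ∧ (∀ t, |t| ≤ |θ t|) ∧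
      ∀ t, |t| ≤ S → |θ t - t| ≤ η * S := by
  have h_pow (t : ℝ) : 0 ≤ (t / S) ^ (2 * m) := (even_two_mul m).pow_nonneg _
  have h_ne : (2 * m + 1 : ℝ) ≠ 0 := by positivity
  let θ : ℝ → ℝ := fun t => t + η / ((2 * m + 1) * S ^ (2 * m)) * t ^ (2 * m + 1)
  have h_eq (t : ℝ) : θ t = t + t * (η / (2 * m + 1) * (t / S) ^ (2 * m)) := by
    simp only [θ, div_pow]
    field_simp
    ring
  refine ⟨1 + C (η / S ^ (2 * m)) * X ^ (2 * m), θ, fun t => ?_, fun t => ?_, fun t => ?_,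
    fun t ht => ?_⟩
  · simp only [eval_add, eval_mul, eval_pow, eval_one, eval_C, eval_X, div_pow]
    ring
  · refine ((hasDerivAt_id' t).fun_add
      ((hasDerivAt_pow (2 * m + 1) t).const_mul _)).congr_deriv ?_
    simp only [eval_add, eval_mul, eval_pow, eval_one, eval_C, eval_X, Nat.cast_add,
      Nat.cast_mul, Nat.cast_ofNat, Nat.cast_one, Nat.add_sub_cancel]
    field_simp
  · have h_nonneg : 0 ≤ η / (2 * m + 1) * (t / S) ^ (2 * m) :=
      mul_nonneg (by positivity) (h_pow t)
    rw [h_eq, ← mul_one_add, abs_mul]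
    exact le_mul_of_one_le_right (abs_nonneg t)
      ((le_add_of_nonneg_right h_nonneg).trans (le_abs_self _))
  · have h_le : η / (2 * m + 1) * (t / S) ^ (2 * m) ≤ η :=
      (mul_le_of_le_one_right (by positivity) (div_pow_two_mul_le_one hS ht m)).trans
        (div_le_self hη.le (by simp))
    rw [h_eq, add_sub_cancel_left, abs_mul, abs_of_nonneg (mul_nonneg (by positivity) (h_pow t)),
      mul_comm]
    gcongr

end Stretching

variable {n : ℕ} {E : Type*} [NormedAddCommGroup E]

theorem exists_isPolynomialCurve_near_of_norm_le {u : ℝ → KnotEuclidean n} (hu : Continuous u)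
    {S ε η : ℝ} (hS : 0 < S) (hε : 0 < ε) (hη : 0 < η) (hu_le : ∀ t, S ≤ |t| → ‖u t‖ ≤ ε) :
    ∃ (κ : ℝ → KnotEuclidean n) (m : ℕ), IsPolynomialCurve κ ∧
      (∀ t, |t| ≤ S → ‖κ t - u t‖ ≤ ε) ∧
      ∀ t, S ≤ |t| → ‖κ t‖ ≤ 2 * ε * (1 + η * (t / S) ^ (2 * m)) := by
  obtain ⟨κ, hκ, h_near⟩ := exists_isPolynomialCurve_near hu (S + 1) hε
  obtain ⟨m, hm⟩ := hκ.exists_forall_norm_le_mul_pow hS (mul_pos (mul_pos two_pos hε) hη)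
  refine ⟨κ, m, hκ, fun t ht => h_near t (by linarith), fun t ht => ?_⟩
  have h_pow : 0 ≤ (t / S) ^ (2 * m) := (even_two_mul m).pow_nonneg _
  rcases le_total |t| (S + 1) with htS | htS
  · calc ‖κ t‖ ≤ ‖κ t - u t‖ + ‖u t‖ := by simpa using norm_add_le (κ t - u t) (u t)
      _ ≤ 2 * ε := by linarith [h_near t htS, hu_le t ht]
      _ ≤ 2 * ε * (1 + η * (t / S) ^ (2 * m)) :=
        le_mul_of_one_le_right (by positivity) (le_add_of_nonneg_right (by positivity))
  · calc ‖κ t‖ ≤ 2 * ε * η * (t / S) ^ (2 * m) := hm t htS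
      _ ≤ 2 * ε * (1 + η * (t / S) ^ (2 * m)) := by linarith

theorem exists_tail_radius_and_stretching_rate (u : C₀(ℝ, E)) {ε : ℝ} (hε : 0 < ε) :
    ∃ S η, 0 < S ∧ 0 < η ∧ (∀ t, S ≤ |t| → ‖u t‖ ≤ ε) ∧ (∀ t, η * ‖u t‖ ≤ ε) ∧
      ∀ s t, |s - t| ≤ η * S → ‖u s - u t‖ ≤ ε := by
  obtain ⟨b, hb, hu_b⟩ : ∃ b, 0 < b ∧ ∀ t, ‖u t‖ ≤ b :=
    ⟨‖u.toBCF‖ + 1, by positivity, fun t => (u.toBCF.norm_coe_le_norm t).trans (by simp)⟩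
  obtain ⟨δ, hδ, h_unif⟩ := Metric.uniformContinuous_iff.1
    (ZeroAtInftyContinuousMap.uniformContinuous u) ε hε
  obtain ⟨R, -, hR⟩ := (hasBasis_cobounded_norm (E := ℝ)).eventually_iff.1 <|
    Metric.cobounded_eq_cocompact (α := ℝ) ▸
      (zero_at_infty u).norm.eventually_le_const (norm_zero.trans_lt hε)
  obtain ⟨S, hS, hRS⟩ : ∃ S, 0 < S ∧ R ≤ S := ⟨max R 1, by positivity, le_max_left _ _⟩
  obtain ⟨η, hη, hηb, hηS⟩ : ∃ η, 0 < η ∧ η * b ≤ ε ∧ η * S < δ := by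
    refine ⟨min (ε / b) (δ / 2 / S), by positivity, ?_, ?_⟩
    · exact (le_div_iff₀ hb).1 (min_le_left _ _)
    · exact ((le_div_iff₀ hS).1 (min_le_right _ _)).trans_lt (half_lt_self hδ)
  refine ⟨S, η, hS, hη, fun t ht => hR (hRS.trans ht),
    fun t => (mul_le_mul_of_nonneg_left (hu_b t) hη.le).trans hηb, fun s t hst => ?_⟩
  rw [← dist_eq_norm]
  exact (h_unif (hst.trans_lt hηS)).le

theorem norm_sub_smul_le_of_near [NormedSpace ℝ E] {x y z : E} {r η ε : ℝ} (hr : 1 ≤ r)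
    (hrη : r - 1 ≤ η) (hxy : ‖x - y‖ ≤ ε) (hyz : ‖y - z‖ ≤ ε) (hz : η * ‖z‖ ≤ ε) :
    ‖x - r • z‖ ≤ 3 * ε := by
  have h_smul : ‖(1 - r) • z‖ ≤ ε := by
    rw [norm_smul, norm_sub_rev, Real.norm_of_nonneg (sub_nonneg.2 hr)]
    exact (mul_le_mul_of_nonneg_right hrη (norm_nonneg z)).trans hz
  have h_split : x - r • z = x - y + (y - z) + (1 - r) • z := by
    rw [sub_smul, one_smul]
    abel
  rw [h_split]
  linarith [norm_add₃_le (a := x - y) (b := y - z) (c := (1 - r) • z)]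

theorem exists_isPolynomialCurve_near_smul_comp (u : C₀(ℝ, KnotEuclidean n)) {ε : ℝ} (hε : 0 < ε) :
    ∃ (κ : ℝ → KnotEuclidean n) (ρ : ℝ[X]) (θ : ℝ → ℝ), IsPolynomialCurve κ ∧
      (∀ t, 1 ≤ ρ.eval t) ∧ (∀ t, HasDerivAt θ (ρ.eval t) t) ∧
      ∀ t, ‖κ t - ρ.eval t • u (θ t)‖ ≤ ε * ρ.eval t := by
  have hε' : 0 < ε / 3 := by positivity
  obtain ⟨S, η, hS, hη, hu_tail, hu_bdd, hu_unif⟩ := exists_tail_radius_and_stretching_rate u hε'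
  obtain ⟨κ, m, hκ, h_near, h_far⟩ :=
    exists_isPolynomialCurve_near_of_norm_le (map_continuous u) hS hε' hη hu_tail
  obtain ⟨ρ, θ, hρ, hθ, hθ_abs, hθ_near⟩ := exists_polynomial_stretching hS hη m
  have hρ_one (t : ℝ) : 1 ≤ ρ.eval t :=
    hρ t ▸ le_add_of_nonneg_right (mul_nonneg hη.le ((even_two_mul m).pow_nonneg _))
  refine ⟨κ, ρ, θ, hκ, hρ_one, hθ, fun t => ?_⟩
  rcases le_total |t| S with ht | ht
  · have hρ_sub : ρ.eval t - 1 ≤ η := by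
      rw [hρ, add_sub_cancel_left]
      exact mul_le_of_le_one_right hη.le (div_pow_two_mul_le_one hS ht m)
    calc ‖κ t - ρ.eval t • u (θ t)‖ ≤ 3 * (ε / 3) :=
          norm_sub_smul_le_of_near (hρ_one t) hρ_sub (h_near t ht)
            (hu_unif _ _ (abs_sub_comm t _ ▸ hθ_near t ht)) (hu_bdd _)
      _ = ε := mul_div_cancel₀ ε three_ne_zero
      _ ≤ ε * ρ.eval t := le_mul_of_one_le_right hε.le (hρ_one t)
  · calc ‖κ t - ρ.eval t • u (θ t)‖ ≤ ‖κ t‖ + ‖ρ.eval t • u (θ t)‖ := norm_sub_le _ _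
      _ ≤ 2 * (ε / 3) * ρ.eval t + ρ.eval t * (ε / 3) := by
        rw [norm_smul, Real.norm_of_nonneg (one_pos.le.trans (hρ_one t))]
        gcongr
        · exact hρ t ▸ h_far t ht
        · exact one_pos.le.trans (hρ_one t)
        · exact hu_tail _ (ht.trans (hθ_abs t))
      _ = ε * ρ.eval t := by ring

end PolynomialApproximation

section PolynomialKnots

open scoped NNReal ZeroAtInfty

theorem ne_zero_of_antilipschitzWith_of_hasDerivAt {E : Type*} [NormedAddCommGroup E]
    [NormedSpace ℝ E] {f : ℝ → E} {f' : E} {t : ℝ} {K : ℝ≥0} (hf : AntilipschitzWith K f)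
    (hf' : HasDerivAt f f' t) : f' ≠ 0 := by
  rintro rfl
  have h_bigO : (fun s => s - t) =O[𝓝[≠] t] fun s => f s - f t :=
    .of_bound K (.of_forall fun s => by simpa [dist_eq_norm] using hf.le_mul_dist s t)
  have h_littleO : (fun s => f s - f t) =o[𝓝[≠] t] fun s => s - t := by
    simpa using hf'.isLittleO.mono nhdsWithin_le_nhds
  have h_ne : ∀ᶠ s in 𝓝[≠] t, s - t ≠ 0 :=
    eventually_mem_nhdsWithin.mono fun s hs => sub_ne_zero.2 hs
  exact isLittleO_irrefl h_ne.frequently (h_bigO.trans_isLittleO h_littleO)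

variable {n : ℕ}

theorem IsPolynomialCurve.isPolynomialKnot {κ : ℝ → KnotEuclidean n} (hκ : IsPolynomialCurve κ)
    {K : ℝ≥0} (h_anti : AntilipschitzWith K κ) : IsPolynomialKnot κ where
  polynomial := hκ
  embedding := .of_deriv_ne_zero hκ.contDiff
    (fun t => ne_zero_of_antilipschitzWith_of_hasDerivAt h_anti
      (hκ.contDiff.differentiable one_ne_zero t).hasDerivAt)
    (h_anti.isEmbedding (hκ.contDiff (k := 0)).continuous)

theorem exists_isPolynomialCurve_lipschitzWith_sub {β : ℝ → KnotEuclidean n}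
    (hβ : ContDiff ℝ 1 β) {A : KnotEuclidean n} (hA : Tendsto (deriv β) (cobounded ℝ) (𝓝 A))
    {ε : ℝ≥0} (hε : 0 < ε) :
    ∃ (κ : ℝ → KnotEuclidean n) (θ : ℝ ≃o ℝ), IsPolynomialCurve κ ∧ AntilipschitzWith 1 θ ∧
      LipschitzWith ε fun t => κ (θ.symm t) - β t := by
  let u : C₀(ℝ, KnotEuclidean n) :=
    { toFun t := deriv β t - A
      continuous_toFun := (hβ.continuous_deriv le_rfl).sub continuous_const
      zero_at_infty' := by
        rw [← Metric.cobounded_eq_cocompact]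
        simpa using hA.sub_const A }
  obtain ⟨κ', ρ, θ, hκ', hρ, hθ, h_near⟩ :=
    exists_isPolynomialCurve_near_smul_comp u (NNReal.coe_pos.2 hε)
  obtain ⟨κ, hκ, hκ_deriv⟩ := (hκ'.add (.eval_smul_const ρ A)).exists_hasDerivAt
  have h_anti := antilipschitzWith_one_of_one_le_deriv hθ hρ
  obtain ⟨θ, rfl⟩ := exists_orderIso_eq_of_one_le_deriv hθ hρ
  have h_deriv (t : ℝ) : HasDerivAt (fun t => κ t - β (θ t))
      (κ' t + ρ.eval t • A - ρ.eval t • deriv β (θ t)) t :=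
    (hκ_deriv t).fun_sub
      (((hβ.differentiable one_ne_zero (θ t)).hasDerivAt).scomp t (hθ t))
  have h_deriv_le (t : ℝ) :
      ‖κ' t + ρ.eval t • A - ρ.eval t • deriv β (θ t)‖ ≤ ε * ρ.eval t := by
    convert h_near t using 2
    change _ = κ' t - ρ.eval t • (deriv β (θ t) - A)
    rw [smul_sub]
    abel
  refine ⟨κ, θ, hκ, h_anti, .of_dist_le_mul fun s t => ?_⟩
  wlog hst : s ≤ t generalizing s t
  · simpa only [dist_comm] using this t s (le_of_not_ge hst)
  have h_le := norm_sub_le_sub_of_norm_deriv_le h_deriv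
    (fun r => (hθ r).const_mul (ε : ℝ)) h_deriv_le (θ.symm.monotone hst)
  simp only [OrderIso.apply_symm_apply] at h_le
  rw [dist_comm, dist_eq_norm, dist_comm, Real.dist_eq, abs_of_nonneg (sub_nonneg.2 hst), mul_sub]
  exact h_le

theorem IsLongKnot.exists_isPolynomialKnot_sameKnotType {β : ℝ → KnotEuclidean n}
    (hβ : IsLongKnot β) : ∃ κ : ℝ → KnotEuclidean n, IsPolynomialKnot κ ∧
      SameKnotType (sphericalCompletion κ) (sphericalCompletion β) := by
  obtain ⟨K, hK⟩ := hβ.exists_antilipschitzWith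
  obtain ⟨A, -, hA⟩ := hβ.exists_tendsto_deriv
  obtain ⟨ε, hε, h_extend⟩ := exists_lipschitz_extension_along hK one_half_pos
  obtain ⟨κ, θ, hκ, hθ, h_lip⟩ := exists_isPolynomialCurve_lipschitzWith_sub hβ.contDiff hA hε
  obtain ⟨φ, hφ, h_eq⟩ := h_extend _ h_lip
  have h_half : (1 / 2 : ℝ≥0) < 1 := one_half_lt_one
  obtain rfl : κ = addContractionHomeo h_half hφ ∘ β ∘ θ := by
    ext1 t
    simp [addContractionHomeo_apply, h_eq]
  have h_anti := (antilipschitzWith_addContractionHomeo h_half hφ).comp (hK.comp hθ)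
  have h_orient := orientationPreserving_sphereHomeo (h := addContractionHomeo h_half hφ)
    (eventually_forall_segment_add_contraction h_half hφ)
  exact ⟨_, hκ.isPolynomialKnot h_anti, sameKnotType_sphericalCompletion h_orient β θ⟩

end PolynomialKnots

section Inversion

open EuclideanGeometry
open scoped RealInnerProductSpace

variable {V : Type*} [NormedAddCommGroup V] [InnerProductSpace ℝ V]

theorem tendsto_reflection_orthogonal_singleton {X : Type*} {l : Filter X} {u v : X → V} {a b : V}
    (hu : Tendsto u l (𝓝 a)) (hv : Tendsto v l (𝓝 b)) (ha : a ≠ 0) :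
    Tendsto (fun x => (ℝ ∙ u x)ᗮ.reflection (v x)) l (𝓝 ((ℝ ∙ a)ᗮ.reflection b)) := by
  simp only [Submodule.reflection_orthogonal_apply, Submodule.reflection_singleton_apply,
    RCLike.ofReal_real_eq_id, id_eq]
  have ha' : ‖a‖ ^ 2 ≠ 0 := pow_ne_zero 2 (norm_ne_zero_iff.2 ha)
  exact (((((hu.inner hv).div (hu.norm.pow 2) ha').smul hu).const_smul 2).sub hv).neg

theorem hasDerivAt_inversion_comp_inv {z : ℝ → V} {w : V} {t : ℝ} (R : ℝ) (ht : t ≠ 0)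
    (hz : HasDerivAt z w t⁻¹) (h_ne : z t⁻¹ ≠ z 0) :
    HasDerivAt (fun t => inversion (z 0) R (z t⁻¹))
      (-(R / ‖slope z 0 t⁻¹‖) ^ 2 • (ℝ ∙ slope z 0 t⁻¹)ᗮ.reflection w) t := by
  have h_span : ℝ ∙ slope z 0 t⁻¹ = ℝ ∙ (z t⁻¹ - z 0) := by
    rw [slope_def_module, sub_zero, inv_inv, Submodule.span_singleton_smul_eq ht.isUnit]
  have h_sq : (R / ‖slope z 0 t⁻¹‖) ^ 2 = (R / dist (z t⁻¹) (z 0)) ^ 2 * (t ^ 2)⁻¹ := by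
    rw [slope_def_module, sub_zero, inv_inv, norm_smul, ← dist_eq_norm, Real.norm_eq_abs, div_pow,
      div_pow, mul_pow, sq_abs, mul_comm, ← div_div, div_eq_mul_inv _ (t ^ 2)]
  simp only [h_span, h_sq]
  convert (hasFDerivAt_inversion (R := R) h_ne).comp_hasDerivAt t
    (hz.scomp t (hasDerivAt_inv ht)) using 1
  · rfl
  · simp [smul_smul]

theorem tendsto_deriv_inversion_comp_inv {z : ℝ → V} {z' : ℝ → V} (R : ℝ)
    (hz : ∀ s, HasDerivAt z (z' s) s) (h_cont : ContinuousAt z' 0) (h_ne : z' 0 ≠ 0) :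
    Tendsto (deriv fun t => inversion (z 0) R (z t⁻¹)) (cobounded ℝ)
      (𝓝 ((R / ‖z' 0‖) ^ 2 • z' 0)) := by
  have h_slope : Tendsto (slope z 0) (𝓝[≠] 0) (𝓝 (z' 0)) := (hz 0).tendsto_slope
  have h_refl := tendsto_reflection_orthogonal_singleton h_slope
    (h_cont.tendsto.mono_left nhdsWithin_le_nhds) h_ne
  rw [Submodule.reflection_orthogonalComplement_singleton_eq_neg] at h_refl
  have h_lim := (((tendsto_const_nhds (x := R)).div h_slope.norm
    (norm_ne_zero_iff.2 h_ne)).pow 2).neg.smul h_refl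
  rw [neg_smul_neg] at h_lim
  refine (h_lim.comp tendsto_inv₀_cobounded').congr' ?_
  filter_upwards [tendsto_inv₀_cobounded'.eventually ((hz 0).eventually_ne h_ne),
    eventually_ne_cobounded 0] with t h_ne ht
  exact (hasDerivAt_inversion_comp_inv R ht (hz _) h_ne).deriv.symm

end Inversion

section OpenKnot

open EuclideanGeometry

variable {n : ℕ}

theorem dropLast_northPole : dropLast n (northPole n).1 = 0 := by
  ext i
  simp [dropLast_apply, northPole, i.castSucc_ne_last]

theorem dist_northPole_sq (p : KnotSphere n) :
    dist p.1 (northPole n).1 ^ 2 = 2 * (1 - p.1 (Fin.last n)) := by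
  rw [dist_eq_norm, norm_sub_sq_real, mem_sphere_zero_iff_norm.1 p.2,
    mem_sphere_zero_iff_norm.1 (northPole n).2, northPole, EuclideanSpace.inner_single_right]
  simp only [one_pow, Real.ringHom_apply, one_mul]
  ring

theorem stereoProj_eq_dropLast_inversion (p : KnotSphere n) :
    stereoProj p.1 = dropLast n (inversion (northPole n).1 √2 p.1) := by
  rw [inversion, div_pow, dist_northPole_sq, Real.sq_sqrt zero_le_two, vsub_eq_sub, vadd_eq_add,
    map_add, map_smul, map_sub, dropLast_northPole, sub_zero, add_zero, stereoProj, ← div_div,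
    div_self two_ne_zero, one_div]

theorem isCkEmbedding_neg_stereoInclusion_neg {k : WithTop ℕ∞} (hk : k ≠ 0) :
    IsCkEmbedding 𝓘(ℝ, KnotEuclidean n) (𝓡 n) k
      fun x : KnotEuclidean n => -stereoInclusion (-x) := by
  have h_emb : IsCkEmbedding 𝓘(ℝ, KnotEuclidean n) 𝓘(ℝ, KnotEuclidean (n + 1)) k
      fun x : KnotEuclidean n => -stereoCoords (-x) := by
    refine .of_leftInverse (g := fun y => -stereoProj (-y))
      (contDiff_stereoCoords.comp contDiff_neg).neg (fun x => ?_) (fun x => ?_) hk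
    · simp [stereoProj_stereoCoords]
    · have h_diff : DifferentiableAt ℝ stereoProj (- -stereoCoords (-x)) := by
        rw [neg_neg]
        exact (contDiffAt_stereoProj (last_ne_one_of_ne_northPole
          (stereoInclusion_ne_northPole (-x)))).differentiableAt one_ne_zero
      exact (h_diff.comp _ differentiableAt_id.neg).fun_neg
  exact h_emb.codRestrict_knotSphere (n := n) (fun x => (-stereoInclusion (-x)).2) hk

theorem neg_stereoInclusion_neg_lineIso_inv {t : ℝ} (ht : t ≠ 0) :
    -stereoInclusion (-lineIso t⁻¹) = stereoInclusion (lineIso t) := by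
  ext i
  have h_pos : t ^ 2 + 1 ≠ 0 := by positivity
  induction i using Fin.lastCases with
  | last =>
    change -stereoCoords (-lineIso t⁻¹) (Fin.last 1) = stereoCoords (lineIso t) (Fin.last 1)
    simp only [stereoCoords_last, norm_neg, LinearIsometryEquiv.norm_map, norm_inv,
      Real.norm_eq_abs, inv_pow, sq_abs]
    field_simp
    ring
  | cast i =>
    change -stereoCoords (-lineIso t⁻¹) i.castSucc = stereoCoords (lineIso t) i.castSucc
    simp only [stereoCoords_castSucc, norm_neg, LinearIsometryEquiv.norm_map, norm_inv,
      Real.norm_eq_abs, inv_pow, sq_abs, PiLp.neg_apply, lineIso_apply]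
    field_simp
    ring

theorem neg_stereoInclusion_zero : -stereoInclusion (0 : KnotEuclidean n) = northPole n := by
  ext i
  induction i using Fin.lastCases with
  | last => simp [stereoInclusion, stereoCoords_last, northPole]
  | cast i => simp [stereoInclusion, stereoCoords_castSucc, northPole, i.castSucc_ne_last]

theorem isCkEmbedding_lineIso {k : WithTop ℕ∞} (hk : k ≠ 0) :
    IsCkEmbedding 𝓘(ℝ, ℝ) 𝓘(ℝ, KnotEuclidean 1) k lineIso :=
  .of_leftInverse lineIso.contDiff lineIso.symm_apply_apply
    (fun _ => lineIso.symm.differentiable.differentiableAt) hk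

/-- The curve in `ℝⁿ` obtained from a knot in `Sⁿ` through the north pole by removing the pole
from source and target; it is meaningful for knots that take the pole, and only it, to the
pole. -/
noncomputable def openKnot (α : KnotSphere 1 → KnotSphere n) (t : ℝ) : KnotEuclidean n :=
  stereoProj (α (stereoInclusion (lineIso t))).1

variable {α : KnotSphere 1 → KnotSphere n}

theorem stereoInclusion_openKnot (hα : Function.Injective α)
    (hN : α (northPole 1) = northPole n) (t : ℝ) :
    stereoInclusion (openKnot α t) = α (stereoInclusion (lineIso t)) :=
  stereoInclusion_stereoProj (hN ▸ hα.ne (stereoInclusion_ne_northPole _))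

theorem sphericalCompletion_openKnot (hα : Function.Injective α)
    (hN : α (northPole 1) = northPole n) : sphericalCompletion (openKnot α) = α := by
  funext p
  obtain ⟨z, rfl⟩ := (stereoOnePoint 1).surjective p
  rw [sphericalCompletion_stereoOnePoint]
  induction z using OnePoint.rec with
  | infty => exact hN.symm
  | coe x =>
    refine (stereoInclusion_openKnot hα hN _).trans ?_
    rw [lineIso.apply_symm_apply]
    rfl

theorem isCkEmbedding_openKnot (hα : IsCkEmbedding (𝓡 1) (𝓡 n) 1 α)
    (hN : α (northPole 1) = northPole n) :
    IsCkEmbedding 𝓘(ℝ, ℝ) 𝓘(ℝ, KnotEuclidean n) 1 (openKnot α) := by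
  have h_emb : IsCkEmbedding 𝓘(ℝ, ℝ) (𝓡 n) 1 fun t => α (stereoInclusion (lineIso t)) :=
    hα.comp ((isCkEmbedding_stereoInclusion one_ne_zero).comp
      (isCkEmbedding_lineIso one_ne_zero) one_ne_zero) one_ne_zero
  have h_eq : stereoInclusion ∘ openKnot α = fun t => α (stereoInclusion (lineIso t)) :=
    funext (stereoInclusion_openKnot hα.isEmbedding.injective hN)
  refine .of_comp (isCkEmbedding_stereoInclusion one_ne_zero).contMDiff ?_ (h_eq ▸ h_emb)
    one_ne_zero
  refine ContDiff.contMDiff (contDiff_iff_contDiffAt.2 fun t => ?_)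
  exact (contDiffAt_stereoProj (last_ne_one_of_ne_northPole
    (hN ▸ hα.isEmbedding.injective.ne (stereoInclusion_ne_northPole _)))).comp t
    ((IsCkEmbedding.coe_knotSphere.comp h_emb one_ne_zero).contMDiff.contDiff.contDiffAt)

theorem dropLast_ne_zero_of_inner_northPole_eq_zero {v : KnotEuclidean (n + 1)}
    (hv : inner ℝ (northPole n).1 v = 0) (hv_ne : v ≠ 0) : dropLast n v ≠ 0 := by
  refine fun h => hv_ne ?_
  ext i
  induction i using Fin.lastCases with
  | last => simpa [northPole, EuclideanSpace.inner_single_left] using hv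
  | cast i => exact congrArg (fun y : KnotEuclidean n => y i) h

theorem exists_tendsto_deriv_openKnot (hα : IsCkEmbedding (𝓡 1) (𝓡 n) 1 α)
    (hN : α (northPole 1) = northPole n) :
    ∃ A ≠ 0, Tendsto (deriv (openKnot α)) (cobounded ℝ) (𝓝 A) := by
  let z (s : ℝ) : KnotEuclidean (n + 1) := (α (-stereoInclusion (-lineIso s))).1
  have hz : IsCkEmbedding 𝓘(ℝ, ℝ) 𝓘(ℝ, KnotEuclidean (n + 1)) 1 z :=
    (IsCkEmbedding.coe_knotSphere.comp hα one_ne_zero).comp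
      ((isCkEmbedding_neg_stereoInclusion_neg one_ne_zero).comp
        (isCkEmbedding_lineIso one_ne_zero) one_ne_zero) one_ne_zero
  have hz_zero : z 0 = (northPole n).1 := by
    simp only [z, map_zero, neg_zero, neg_stereoInclusion_zero, hN]
  have h_deriv (s : ℝ) : HasDerivAt z (deriv z s) s :=
    (hz.contMDiff.contDiff.differentiable one_ne_zero s).hasDerivAt
  have h_ne : deriv z 0 ≠ 0 := hz.deriv_ne_zero 0
  have h_inner : inner ℝ (z 0) (deriv z 0) = 0 := by
    have h_sq : HasDerivAt (fun _ => 1) (2 * inner ℝ (z 0) (deriv z 0)) (0 : ℝ) := by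
      simpa [z] using (h_deriv 0).norm_sq
    linarith [h_sq.unique (hasDerivAt_const 0 1)]
  have h_eq : ∀ᶠ t in cobounded ℝ,
      dropLast n (deriv (fun t => inversion (z 0) √2 (z t⁻¹)) t) = deriv (openKnot α) t := by
    filter_upwards [eventually_ne_cobounded 0] with t ht
    have h_diff := (hasDerivAt_inversion_comp_inv √2 ht (h_deriv _)
      (hz.isEmbedding.injective.ne (inv_ne_zero ht))).differentiableAt.hasDerivAt
    have h_nhds : openKnot α =ᶠ[𝓝 t] fun t => dropLast n (inversion (z 0) √2 (z t⁻¹)) := by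
      filter_upwards [eventually_ne_nhds ht] with r hr
      rw [openKnot, stereoProj_eq_dropLast_inversion, hz_zero,
        ← neg_stereoInclusion_neg_lineIso_inv hr]
    rw [h_nhds.deriv_eq]
    exact ((dropLast n).hasFDerivAt.comp_hasDerivAt t h_diff).deriv.symm
  have h_lim := tendsto_deriv_inversion_comp_inv √2 h_deriv
    (hz.contMDiff.contDiff.continuous_deriv le_rfl).continuousAt h_ne
  refine ⟨_, ?_, (((dropLast n).continuous.tendsto _).comp h_lim).congr' h_eq⟩
  rw [map_smul]
  refine smul_ne_zero (pow_ne_zero 2 (div_ne_zero (by simp) (norm_ne_zero_iff.2 h_ne))) ?_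
  exact dropLast_ne_zero_of_inner_northPole_eq_zero (hz_zero ▸ h_inner) h_ne

theorem isLongKnot_openKnot (hα : IsCkEmbedding (𝓡 1) (𝓡 n) 1 α)
    (hN : α (northPole 1) = northPole n) : IsLongKnot (openKnot α) where
  contDiff := (isCkEmbedding_openKnot hα hN).contMDiff.contDiff
  injective := (isCkEmbedding_openKnot hα hN).isEmbedding.injective
  deriv_ne_zero := (isCkEmbedding_openKnot hα hN).deriv_ne_zero
  exists_tendsto_deriv := exists_tendsto_deriv_openKnot hα hN

end OpenKnot

section Rotation

theorem exists_ne_zero_reflection_orthogonal_eq {V : Type*} [NormedAddCommGroup V]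
    [InnerProductSpace ℝ V] (hV : 1 < Module.finrank ℝ V) {x y : V} (h_norm : ‖x‖ = ‖y‖) :
    ∃ v : V, v ≠ 0 ∧ (ℝ ∙ v)ᗮ.reflection x = y := by
  rcases eq_or_ne x y with rfl | hxy
  · have h_orth : (ℝ ∙ x)ᗮ ≠ ⊥ := fun h => hV.not_ge <| by
      rw [← finrank_top ℝ V, ← (Submodule.orthogonal_eq_bot_iff.1 h)]
      exact (finrank_span_le_card _).trans_eq (by simp)
    obtain ⟨v, hv, hv_ne⟩ := Submodule.exists_mem_ne_zero_of_ne_bot h_orth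
    refine ⟨v, hv_ne, Submodule.reflection_mem_subspace_eq_self ?_⟩
    rwa [Submodule.mem_orthogonal_singleton_iff_inner_left,
      ← Submodule.mem_orthogonal_singleton_iff_inner_right]
  · exact ⟨x - y, sub_ne_zero.2 hxy, Submodule.reflection_sub h_norm⟩

variable {n : ℕ}

/-- The homeomorphism of the sphere that a linear isometry of the ambient space restricts to. -/
noncomputable def sphereIsometry (L : KnotEuclidean (n + 1) ≃ₗᵢ[ℝ] KnotEuclidean (n + 1)) :
    KnotSphere n ≃ₜ KnotSphere n :=
  L.toHomeomorph.subtype fun x => by simp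

theorem coe_sphereIsometry (L : KnotEuclidean (n + 1) ≃ₗᵢ[ℝ] KnotEuclidean (n + 1))
    (p : KnotSphere n) : (sphereIsometry L p).1 = L p.1 :=
  rfl

theorem one_lt_finrank_knotEuclidean_succ (hn : 0 < n) :
    1 < Module.finrank ℝ (KnotEuclidean (n + 1)) := by
  rw [finrank_euclideanSpace_fin]
  omega

theorem orientationPreserving_sphereIsometry_reflection_trans (hn : 0 < n)
    {u v : KnotEuclidean (n + 1)} (hu : u ≠ 0) (hv : v ≠ 0) :
    OrientationPreserving
      (sphereIsometry ((ℝ ∙ u)ᗮ.reflection.trans (ℝ ∙ v)ᗮ.reflection)) := by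
  obtain ⟨γ, hγ⟩ := (isPathConnected_compl_singleton_of_one_lt_rank
    (Module.lt_rank_of_lt_finrank (one_lt_finrank_knotEuclidean_succ hn)) 0).joinedIn v hv u hu
  have h_path : Continuous fun q : unitInterval × KnotSphere n => γ q.1 := by fun_prop
  have h_fixed : Continuous fun q : unitInterval × KnotSphere n => (ℝ ∙ u)ᗮ.reflection q.2.1 :=
    (ℝ ∙ u)ᗮ.reflection.continuous.comp (continuous_subtype_val.comp continuous_snd)
  have h_cont : Continuous fun q : unitInterval × KnotSphere n =>
      (ℝ ∙ γ q.1)ᗮ.reflection ((ℝ ∙ u)ᗮ.reflection q.2.1) :=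
    continuous_iff_continuousAt.2 fun q =>
      tendsto_reflection_orthogonal_singleton (h_path.tendsto q) (h_fixed.tendsto q) (hγ q.1)
  exact .of_homotopy
    { toFun := fun q => sphereIsometry ((ℝ ∙ u)ᗮ.reflection.trans (ℝ ∙ γ q.1)ᗮ.reflection) q.2
      continuous_toFun := h_cont.subtype_mk _
      map_zero_left := fun p => by simp
      map_one_left := fun p => Subtype.ext (by simp [coe_sphereIsometry]) }

theorem exists_orientationPreserving_sphereIsometry_eq_northPole (hn : 0 < n) (p : KnotSphere n) :
    ∃ L : KnotEuclidean (n + 1) ≃ₗᵢ[ℝ] KnotEuclidean (n + 1),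
      OrientationPreserving (sphereIsometry L) ∧ sphereIsometry L p = northPole n := by
  obtain ⟨v, hv, hvp⟩ := exists_ne_zero_reflection_orthogonal_eq
    (x := -p.1) (y := (northPole n).1) (one_lt_finrank_knotEuclidean_succ hn) (by simp)
  have hp : p.1 ≠ 0 := ne_zero_of_mem_unit_sphere p
  refine ⟨_, orientationPreserving_sphereIsometry_reflection_trans hn hp hv, Subtype.ext ?_⟩
  rw [coe_sphereIsometry, LinearIsometryEquiv.trans_apply,
    Submodule.reflection_orthogonalComplement_singleton_eq_neg, hvp]

theorem isCkEmbedding_sphereIsometry_comp {α : KnotSphere 1 → KnotSphere n}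
    (hα : IsCkEmbedding (𝓡 1) (𝓡 n) 1 α)
    (L : KnotEuclidean (n + 1) ≃ₗᵢ[ℝ] KnotEuclidean (n + 1)) :
    IsCkEmbedding (𝓡 1) (𝓡 n) 1 (sphereIsometry L ∘ α) := by
  have hL : IsCkEmbedding 𝓘(ℝ, KnotEuclidean (n + 1)) 𝓘(ℝ, KnotEuclidean (n + 1)) 1 L :=
    .of_leftInverse L.contDiff L.symm_apply_apply
      (fun _ => L.symm.differentiable.differentiableAt) one_ne_zero
  exact (hL.comp (IsCkEmbedding.coe_knotSphere.comp hα one_ne_zero) one_ne_zero)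
    |>.codRestrict_knotSphere (fun p => (sphereIsometry L (α p)).2) one_ne_zero

end Rotation

theorem exists_isPolynomialKnot_sameKnotType {n : ℕ} (hn : 0 < n) {α : KnotSphere 1 → KnotSphere n}
    (hα : IsCkEmbedding (𝓡 1) (𝓡 n) 1 α) :
    ∃ κ : ℝ → KnotEuclidean n, IsPolynomialKnot κ ∧ SameKnotType (sphericalCompletion κ) α := by
  obtain ⟨L, hL, hLN⟩ := exists_orientationPreserving_sphereIsometry_eq_northPole hn
    (α (northPole 1))
  have hLα := isCkEmbedding_sphereIsometry_comp hα L
  obtain ⟨κ, hκ, f, g, hf, hg, h_eq⟩ :=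
    (isLongKnot_openKnot hLα hLN).exists_isPolynomialKnot_sameKnotType
  rw [sphericalCompletion_openKnot hLα.isEmbedding.injective hLN] at h_eq
  exact ⟨κ, hκ, f, (sphereIsometry L).trans g, hf, hL.trans hg, h_eq⟩

theorem mainTheorem4_general {n : ℕ} (hn : 0 < n) {k : WithTop ℕ∞} (hk : 1 ≤ k) :
    (∀ α : KnotSphere 1 → KnotSphere n, IsCkEmbedding (𝓡 1) (𝓡 n) k α →
      ∃ κ : ℝ → KnotEuclidean n, IsPolynomialKnot κ ∧
        SameKnotType (sphericalCompletion κ) α) ∧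
    (∀ α : KnotSphere 1 → KnotEuclidean n, IsCkEmbedding (𝓡 1) 𝓘(ℝ, KnotEuclidean n) k α →
      ∃ κ : ℝ → KnotEuclidean n, IsPolynomialKnot κ ∧
        SameKnotType (sphericalCompletion κ) (stereoInclusion ∘ α)) :=
  ⟨fun _ hα => exists_isPolynomialKnot_sameKnotType hn (hα.of_le hk), fun _ hα =>
    exists_isPolynomialKnot_sameKnotType hn
      ((isCkEmbedding_stereoInclusion one_ne_zero).comp (hα.of_le hk) one_ne_zero)⟩

/-- Every `C²` knot in `S³`, and every `C²` knot in `ℝ³` (regarded as a knot in `S³` through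
stereographic projection), has the same knot type as the spherical completion of a polynomial
knot `ℝ → ℝ³`. -/
theorem mainTheorem4 :
    (∀ α : KnotSphere 1 → KnotSphere 3, IsCkEmbedding (𝓡 1) (𝓡 3) 2 α →
      ∃ κ : ℝ → KnotEuclidean 3, IsPolynomialKnot κ ∧
        SameKnotType (sphericalCompletion κ) α) ∧
    (∀ α : KnotSphere 1 → KnotEuclidean 3, IsCkEmbedding (𝓡 1) 𝓘(ℝ, KnotEuclidean 3) 2 α →
      ∃ κ : ℝ → KnotEuclidean 3, IsPolynomialKnot κ ∧
        SameKnotType (sphericalCompletion κ) (stereoInclusion ∘ α)) := by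
  exact mainTheorem4_general three_pos one_le_two
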